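/- Let $d\in\{2,3\}$ and put $\phi_0(x,y)=-\frac{1}{2\pi}\log|x-y|$ if $d=2$ and $\phi_0(x,y)=\frac{1}{4\pi|x-y|}$ if $d=3$. For a bounded open set $\Omega\subset\mathbb{R}^d$ let $N_\Omega:L^2(\Omega)\to L^2(\Omega)$, $N_\Omega f(x)=\int_\Omega \phi_0(x,y)f(y)\,dy$, be the Newtonian potential operator on real $L^2(\Omega)$. For $k=0,1,2,\dots$ let $\lambda_k(\Omega)$ be the $(k+1)$-th largest eigenvalue of $N_\Omega$, counted with multiplicity; that is, $\lambda_k(\Omega)$ is the number $\lambda$ such that at most $k$ eigenvalues (with multiplicity) are greater than $\lambda$, and more than $k$ eigenvalues (with multiplicity) are greater than or equal to $\lambda$. Let $\Omega_1\subset\Omega_2\subset\mathbb{R}^d$ be nonempty bounded open sets (for instance bounded Lipschitz domains). Then for every $k\ge 0$ the eigenvalues $\lambda_k(\Omega_1)$ and $\lambda_k(\Omega_2)$ exist, and $$\lambda_k(\Omega_1)\le\lambda_k(\Omega_2).$$ -/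

import Mathlib

open MeasureTheory Metric Set

noncomputable section

namespace Newtonian

/-- `L²(Ω)`, real valued, with respect to Lebesgue measure on `Ω ⊆ ℝᵈ`. -/
abbrev L2 {d : ℕ} (Ω : Set (EuclideanSpace ℝ (Fin d))) : Type :=
  Lp ℝ 2 ((volume : Measure (EuclideanSpace ℝ (Fin d))).restrict Ω)

/-- The fundamental solution of `-Δ` in dimensions two and three, as a function of `x - y`.
(The value `0` in other dimensions is a placeholder, never used below.) -/
def fundamentalSolution {d : ℕ} (z : EuclideanSpace ℝ (Fin d)) : ℝ :=
  if d = 2 then -1 / (2 * Real.pi) * Real.log ‖z‖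
  else if d = 3 then 1 / (4 * Real.pi * ‖z‖)
  else 0

/-- The Newtonian potential `x ↦ ∫_Ω φ₀(x, y) f(y) dy`. -/
def potential {d : ℕ} (Ω : Set (EuclideanSpace ℝ (Fin d)))
    (f : EuclideanSpace ℝ (Fin d) → ℝ) (x : EuclideanSpace ℝ (Fin d)) : ℝ :=
  ∫ y in Ω, fundamentalSolution (x - y) * f y

lemma measurable_fundamentalSolution {d : ℕ} :
    Measurable (fundamentalSolution : EuclideanSpace ℝ (Fin d) → ℝ) := by
  unfold fundamentalSolution
  split_ifs <;> fun_prop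

lemma integrableOn_mul_log_sq (R : ℝ) :
    IntegrableOn (fun y : ℝ => y * Real.log y ^ 2) (Ioo 0 R) := by
  have hc : Continuous fun y : ℝ => y * Real.log y ^ 2 := by
    have h : (fun y : ℝ => y * Real.log y ^ 2)
        = fun y : ℝ => 4 * (Real.sqrt y * Real.log (Real.sqrt y)) ^ 2 +
            (y - Real.sqrt y ^ 2) * Real.log y ^ 2 := by
      funext y
      rcases le_or_gt 0 y with hy | hy
      · rw [Real.log_sqrt hy, mul_pow, Real.sq_sqrt hy]; ring
      · rw [Real.sqrt_eq_zero_of_nonpos hy.le]; simp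
    have h2 : Continuous fun y : ℝ => y * Real.log y := Real.continuous_mul_log
    refine continuous_iff_continuousAt.2 fun y => ?_
    rcases eq_or_ne y 0 with rfl | hy
    · have h3 : Continuous fun y : ℝ =>
          4 * (Real.sqrt |y| * Real.log (Real.sqrt |y|)) ^ 2 := by
        have := h2.comp (Real.continuous_sqrt.comp continuous_abs)
        exact continuous_const.mul (this.pow 2)
      have h4 := h3.tendsto 0
      rw [ContinuousAt]
      simp only [zero_mul]
      refine squeeze_zero_norm (a := fun y : ℝ =>
          4 * (Real.sqrt |y| * Real.log (Real.sqrt |y|)) ^ 2) (fun y => ?_) ?_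
      · rw [Real.log_sqrt (abs_nonneg y), mul_pow, Real.sq_sqrt (abs_nonneg y), Real.log_abs,
          norm_mul, Real.norm_eq_abs, Real.norm_eq_abs, abs_of_nonneg (sq_nonneg (Real.log y))]
        apply le_of_eq; ring
      · simpa using h4
    · exact continuousAt_id.mul ((Real.continuousAt_log hy).pow 2)
  exact (hc.integrableOn_Icc (a := 0) (b := R)).mono_set Ioo_subset_Icc_self

lemma integrableOn_fundamentalSolution_sq {d : ℕ} (R : ℝ) :
    IntegrableOn (fun z : EuclideanSpace ℝ (Fin d) => fundamentalSolution z ^ 2) (ball 0 R) := by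
  by_cases h2 : d = 2
  · subst h2
    have := (integrableOn_fun_norm_addHaar (E := EuclideanSpace ℝ (Fin 2)) volume
      (f := fun r => (-1 / (2 * Real.pi) * Real.log r) ^ 2) (r := R)).2 (by
        have h : IntegrableOn (fun y : ℝ =>
            (-1 / (2 * Real.pi)) ^ 2 * (y * Real.log y ^ 2)) (Ioo 0 R) :=
          (integrableOn_mul_log_sq R).const_mul ((-1 / (2 * Real.pi)) ^ 2)
        refine h.congr_fun (fun y _ => ?_) measurableSet_Ioo
        simp [mul_pow]; ring)
    simpa [fundamentalSolution] using this
  by_cases h3 : d = 3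
  · subst h3
    have := (integrableOn_fun_norm_addHaar (E := EuclideanSpace ℝ (Fin 3)) volume
      (f := fun r => (1 / (4 * Real.pi * r)) ^ 2) (r := R)).2 (by
        have h : IntegrableOn (fun _ : ℝ => (1 / (4 * Real.pi)) ^ 2) (Ioo 0 R) :=
          integrableOn_const (by simp)
        refine h.congr_fun (fun y hy => ?_) measurableSet_Ioo
        have : y ≠ 0 := hy.1.ne'
        simp
        field_simp)
    simpa [fundamentalSolution] using this
  · simp [fundamentalSolution, h2, h3]

section operator

variable {d : ℕ} {Ω : Set (EuclideanSpace ℝ (Fin d))}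

lemma integrable_kernel_sq {R : ℝ} (hR : Ω ⊆ ball 0 R) {x : EuclideanSpace ℝ (Fin d)}
    (hx : x ∈ ball 0 R) :
    Integrable (fun y => fundamentalSolution (x - y) ^ 2) (volume.restrict Ω) ∧
    ∫ y in Ω, fundamentalSolution (x - y) ^ 2
      ≤ ∫ z in ball (0 : EuclideanSpace ℝ (Fin d)) (2 * R), fundamentalSolution z ^ 2 := by
  have hmp := Measure.measurePreserving_sub_left (volume : Measure (EuclideanSpace ℝ (Fin d))) x
  have hemb : MeasurableEmbedding fun y : EuclideanSpace ℝ (Fin d) => x - y :=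
    (MeasurableEquiv.subLeft x).measurableEmbedding
  have hsub : Ω ⊆ (fun y => x - y) ⁻¹' ball 0 (2 * R) := by
    intro y hy
    have h1 := mem_ball_zero_iff.1 (hR hy)
    have h2 := mem_ball_zero_iff.1 hx
    have h3 := norm_sub_le x y
    simp only [mem_preimage, mem_ball_zero_iff]
    linarith
  have hint : IntegrableOn (fun y => fundamentalSolution (x - y) ^ 2)
      ((fun y => x - y) ⁻¹' ball 0 (2 * R)) :=
    (hmp.integrableOn_comp_preimage hemb
      (f := fun z => fundamentalSolution z ^ 2)).2 (integrableOn_fundamentalSolution_sq _)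
  refine ⟨hint.mono_set hsub, ?_⟩
  rw [← hmp.setIntegral_preimage_emb hemb (fun z => fundamentalSolution z ^ 2)]
  exact setIntegral_mono_set hint (Filter.Eventually.of_forall fun y => sq_nonneg _)
    (Filter.Eventually.of_forall hsub)

lemma integrable_kernel_mul {R : ℝ} (hR : Ω ⊆ ball 0 R) {x : EuclideanSpace ℝ (Fin d)}
    (hx : x ∈ ball 0 R) (f : L2 Ω) :
    Integrable (fun y => fundamentalSolution (x - y) * f y) (volume.restrict Ω) := by
  have hm : AEStronglyMeasurable (fun y => fundamentalSolution (x - y)) (volume.restrict Ω) :=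
    (measurable_fundamentalSolution.comp (measurable_const.sub measurable_id)).aestronglyMeasurable
  exact ((memLp_two_iff_integrable_sq hm).2 (integrable_kernel_sq hR hx).1).integrable_mul
    (Lp.memLp f)

lemma ae_mem_ball {R : ℝ} (hR : Ω ⊆ ball 0 R) :
    ∀ᵐ x ∂(volume.restrict Ω : Measure (EuclideanSpace ℝ (Fin d))),
      x ∈ ball (0 : EuclideanSpace ℝ (Fin d)) R :=
  ae_mono (Measure.restrict_mono hR le_rfl) (ae_restrict_mem measurableSet_ball)

/-- On a bounded set, the potential of a square-integrable function is square-integrable. -/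
lemma memLp_potential (hΩ : Bornology.IsBounded Ω) (f : L2 Ω) :
    MemLp (potential Ω f) 2 (volume.restrict Ω) := by
  obtain ⟨R, hR⟩ := hΩ.subset_ball 0
  have : IsFiniteMeasure ((volume : Measure (EuclideanSpace ℝ (Fin d))).restrict Ω) :=
    ⟨by simpa using hΩ.measure_lt_top⟩
  have hm : AEStronglyMeasurable (potential Ω f) (volume.restrict Ω) := by
    have h : StronglyMeasurable (fun p : EuclideanSpace ℝ (Fin d) × EuclideanSpace ℝ (Fin d) =>
        fundamentalSolution (p.1 - p.2) * f p.2) :=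
      ((measurable_fundamentalSolution.comp
        (measurable_fst.sub measurable_snd)).stronglyMeasurable).mul
        ((Lp.stronglyMeasurable f).comp_measurable measurable_snd)
    exact (h.integral_prod_right (ν := volume.restrict Ω)).aestronglyMeasurable
  refine MemLp.of_bound hm
    ((∫ z in ball (0 : EuclideanSpace ℝ (Fin d)) (2 * R), fundamentalSolution z ^ 2) +
      ∫ y in Ω, f y ^ 2) ?_
  filter_upwards [ae_mem_ball hR] with x hx
  have hf : Integrable (fun y => f y ^ 2) (volume.restrict Ω) :=
    (memLp_two_iff_integrable_sq (Lp.aestronglyMeasurable f)).1 (Lp.memLp f)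
  obtain ⟨hk, hle⟩ := integrable_kernel_sq hR hx
  calc ‖potential Ω f x‖ ≤ ∫ y in Ω, ‖fundamentalSolution (x - y) * f y‖ :=
        norm_integral_le_integral_norm _
    _ ≤ ∫ y in Ω, (fundamentalSolution (x - y) ^ 2 + f y ^ 2) := by
        refine integral_mono (integrable_kernel_mul hR hx f).norm (hk.add hf) fun y => ?_
        simp only [norm_mul, Real.norm_eq_abs]
        nlinarith [sq_nonneg (|fundamentalSolution (x - y)| - |f y|),
          sq_abs (fundamentalSolution (x - y)), sq_abs (f y),
          sq_nonneg (|fundamentalSolution (x - y)|), sq_nonneg |f y|]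
    _ = (∫ y in Ω, fundamentalSolution (x - y) ^ 2) + ∫ y in Ω, f y ^ 2 := integral_add hk hf
    _ ≤ _ := by gcongr

/-- The Newtonian potential operator `N_Ω : L²(Ω) → L²(Ω)` of a bounded set `Ω`. -/
def newtonianOperator (Ω : Set (EuclideanSpace ℝ (Fin d))) (hΩ : Bornology.IsBounded Ω) :
    L2 Ω →ₗ[ℝ] L2 Ω where
  toFun f := (memLp_potential hΩ f).toLp (potential Ω f)
  map_add' f g := by
    rw [← MemLp.toLp_add, MemLp.toLp_eq_toLp_iff]
    obtain ⟨R, hR⟩ := hΩ.subset_ball 0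
    filter_upwards [ae_mem_ball hR] with x hx
    rw [Pi.add_apply, potential, potential, potential,
      ← integral_add (integrable_kernel_mul hR hx f) (integrable_kernel_mul hR hx g)]
    refine integral_congr_ae ?_
    filter_upwards [Lp.coeFn_add f g] with y hy
    rw [hy, Pi.add_apply, mul_add]
  map_smul' c f := by
    rw [RingHom.id_apply, ← MemLp.toLp_const_smul, MemLp.toLp_eq_toLp_iff]
    refine Filter.Eventually.of_forall fun x => ?_
    rw [Pi.smul_apply, smul_eq_mul, potential, potential, ← integral_const_mul]
    refine integral_congr_ae ?_
    filter_upwards [Lp.coeFn_smul c f] with y hy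
    rw [hy, Pi.smul_apply, smul_eq_mul]
    ring

lemma newtonianOperator_apply (hΩ : Bornology.IsBounded Ω) (f : L2 Ω) :
    newtonianOperator Ω hΩ f =ᵐ[volume.restrict Ω]
      fun x => ∫ y in Ω, fundamentalSolution (x - y) * f y :=
  (memLp_potential hΩ f).coeFn_toLp

end operator

section eigenvalues

variable {H : Type} [AddCommGroup H] [Module ℝ H]

/-- The span of all eigenvectors whose eigenvalue lies in `S`. Its dimension is the number of
eigenvalues in `S`, counted with multiplicity. -/
def spectralSubspace (T : H →ₗ[ℝ] H) (S : Set ℝ) : Submodule ℝ H :=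
  ⨆ μ ∈ S, Module.End.eigenspace T μ

/-- `lam` is the eigenvalue of index `k` (indices start at `0`) when the eigenvalues of `T` are
listed in decreasing order and repeated according to multiplicity: at most `k` of them, counted
with multiplicity, exceed `lam`, and more than `k` of them are at least `lam`. -/
def IsKthEigenvalue (T : H →ₗ[ℝ] H) (k : ℕ) (lam : ℝ) : Prop :=
  Module.rank ℝ (spectralSubspace T (Ioi lam)) ≤ (k : Cardinal) ∧
    (k : Cardinal) < Module.rank ℝ (spectralSubspace T (Ici lam))

/-- The eigenvalue of index `k` in the decreasing list: the largest `t` such that more than `k`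
eigenvalues, counted with multiplicity, are at least `t`. -/
def kthEigenvalue (T : H →ₗ[ℝ] H) (k : ℕ) : ℝ :=
  sSup {t : ℝ | (k : Cardinal) < Module.rank ℝ (spectralSubspace T (Ici t))}

lemma spectralSubspace_mono (T : H →ₗ[ℝ] H) {S S' : Set ℝ} (h : S ⊆ S') :
    spectralSubspace T S ≤ spectralSubspace T S' :=
  biSup_mono fun _ hμ => h hμ

/-- There is at most one eigenvalue of index `k`, and it is `kthEigenvalue T k`. -/
lemma IsKthEigenvalue.eq_kthEigenvalue {T : H →ₗ[ℝ] H} {k : ℕ} {lam : ℝ}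
    (h : IsKthEigenvalue T k lam) : lam = kthEigenvalue T k := by
  refine ((IsGreatest.csSup_eq ⟨h.2, fun t ht => ?_⟩ : kthEigenvalue T k = lam)).symm
  by_contra hlt
  have hle := Submodule.rank_mono (spectralSubspace_mono T
    (Ici_subset_Ioi.2 (not_le.1 hlt)) : spectralSubspace T (Ici t) ≤ _)
  exact absurd (lt_of_lt_of_le ht (hle.trans h.1)) (lt_irrefl _)

/-- The eigenvalue of index `k` is an eigenvalue. -/
lemma IsKthEigenvalue.hasEigenvalue {T : H →ₗ[ℝ] H} {k : ℕ} {lam : ℝ}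
    (h : IsKthEigenvalue T k lam) : Module.End.HasEigenvalue T lam := by
  intro hbot
  have hle : spectralSubspace T (Ici lam) ≤ spectralSubspace T (Ioi lam) := by
    refine iSup₂_le fun μ hμ => ?_
    rcases eq_or_lt_of_le (mem_Ici.1 hμ) with rfl | hlt
    · exact (le_of_eq hbot).trans bot_le
    · exact le_biSup (fun μ => Module.End.eigenspace T μ) (mem_Ioi.2 hlt)
  exact absurd (h.2.trans_le ((Submodule.rank_mono hle).trans h.1)) (lt_irrefl _)

end eigenvalues

/-- `λ_k(Ω)`, `k = 0, 1, 2, …`: the eigenvalue of index `k` of the Newtonian potential operator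
of `Ω`, in decreasing order and with multiplicity. -/
def newtonianEigenvalue {d : ℕ} (Ω : Set (EuclideanSpace ℝ (Fin d)))
    (hΩ : Bornology.IsBounded Ω) (k : ℕ) : ℝ :=
  kthEigenvalue (newtonianOperator Ω hΩ) k

end Newtonian

end

/-! The argument is a min-max comparison of eigenvalue counts. The kernel is even and square
integrable on Ω × Ω, so N_Ω is symmetric and Hilbert–Schmidt. Hence only finitely many eigenvalues,
with multiplicity, lie above a positive threshold. On the orthogonal complement of the eigenvectors
with eigenvalue at least t, the form ⟨N f, f⟩ is at most t‖f‖². A space on which the form exceeds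
t‖f‖² therefore projects injectively onto their span (`rank_le_rank_spectralSubspace`).

Extension by zero preserves both the norm and the form, since N_Ω₁ is the compression of N_Ω₂ to
L²(Ω₁). So for 0 < s < t, N_Ω₂ has at least as many eigenvalues ≥ s as N_Ω₁ has ≥ t
(`rank_spectralSubspace_le_of_subset`), and letting s increase to λ_k(Ω₁) gives the inequality.

For λ_k to exist, more than k eigenvalues must be positive. The logarithmic kernel changes sign, so
this is not immediate. It is shown on indicators of k + 1 tiny separated balls: the singularity
makes their self-energies dominate their interactions (`exists_pos_lt_rank_spectralSubspace`). -/

noncomputable section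

namespace Newtonian

/-! ### Spectral counting for symmetric Hilbert–Schmidt maps -/

section hilbertSchmidt

variable {H : Type} [NormedAddCommGroup H] [InnerProductSpace ℝ H]

open scoped InnerProductSpace

/-- A linear map is Hilbert–Schmidt if the sums `∑ ‖T eᵢ‖²` over finite orthonormal families are
bounded. -/
def IsHilbertSchmidt (T : H →ₗ[ℝ] H) : Prop :=
  ∃ C : ℝ, ∀ (n : ℕ) (v : Fin n → H), Orthonormal ℝ v → ∑ i, ‖T (v i)‖ ^ 2 ≤ C

lemma spectralSubspace_le_of_hasEigenvalue {T : H →ₗ[ℝ] H} {S S' : Set ℝ}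
    (h : ∀ μ ∈ S, Module.End.HasEigenvalue T μ → μ ∈ S') :
    spectralSubspace T S ≤ spectralSubspace T S' := by
  refine iSup₂_le fun μ hμ => ?_
  by_cases he : Module.End.HasEigenvalue T μ
  · exact le_biSup (fun μ => Module.End.eigenspace T μ) (h μ hμ he)
  · rw [Module.End.hasEigenvalue_iff, not_not] at he
    rw [he]
    exact bot_le

/-- Expansion of the quadratic form and of the norm on a sum of eigenspaces. -/
lemma exists_expansion_of_mem_spectralSubspace {T : H →ₗ[ℝ] H} (hT : T.IsSymmetric) {S : Set ℝ}
    {x : H} (hx : x ∈ spectralSubspace T S) :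
    ∃ (s : Finset S) (f : S → H),
      ⟪T x, x⟫_ℝ = ∑ i ∈ s, (i : ℝ) * ‖f i‖ ^ 2 ∧ ‖x‖ ^ 2 = ∑ i ∈ s, ‖f i‖ ^ 2 := by
  rw [spectralSubspace, iSup_subtype', Submodule.mem_iSup_iff_exists_finsupp] at hx
  obtain ⟨f, hf, rfl⟩ := hx
  have hO := hT.orthogonalFamily_eigenspaces.comp (Subtype.coe_injective (p := fun μ => μ ∈ S))
  have h1 : T (f.sum fun _ y => y) = ∑ i ∈ f.support, (i : ℝ) • f i := by
    rw [Finsupp.sum, map_sum]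
    exact Finset.sum_congr rfl fun i _ => Module.End.mem_eigenspace_iff.1 (hf i)
  refine ⟨f.support, f, ?_, ?_⟩
  · rw [h1, Finsupp.sum]
    have := hO.inner_sum (fun i => (i : ℝ) • ⟨f i, hf i⟩) (fun i => ⟨f i, hf i⟩) f.support
    simpa [inner_smul_left] using this
  · have := hO.norm_sum (fun i => ⟨f i, hf i⟩) f.support
    simpa [Finsupp.sum] using this

lemma le_inner_of_mem_spectralSubspace_Ici {T : H →ₗ[ℝ] H} (hT : T.IsSymmetric) {t : ℝ}
    {x : H} (hx : x ∈ spectralSubspace T (Ici t)) : t * ‖x‖ ^ 2 ≤ ⟪T x, x⟫_ℝ := by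
  obtain ⟨s, f, h1, h2⟩ := exists_expansion_of_mem_spectralSubspace hT hx
  rw [h1, h2, Finset.mul_sum]
  exact Finset.sum_le_sum fun i _ => mul_le_mul_of_nonneg_right i.2 (sq_nonneg _)

lemma inner_le_of_mem_spectralSubspace_Iio {T : H →ₗ[ℝ] H} (hT : T.IsSymmetric) {t : ℝ}
    {x : H} (hx : x ∈ spectralSubspace T (Iio t)) : ⟪T x, x⟫_ℝ ≤ t * ‖x‖ ^ 2 := by
  obtain ⟨s, f, h1, h2⟩ := exists_expansion_of_mem_spectralSubspace hT hx
  rw [h1, h2, Finset.mul_sum]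
  exact Finset.sum_le_sum fun i _ => mul_le_mul_of_nonneg_right i.2.le (sq_nonneg _)

namespace IsHilbertSchmidt

variable {T : H →ₗ[ℝ] H}

lemma exists_norm_le (hHS : IsHilbertSchmidt T) : ∃ C, ∀ x, ‖T x‖ ≤ C * ‖x‖ := by
  obtain ⟨C, hC⟩ := hHS
  refine ⟨Real.sqrt C, fun x => ?_⟩
  rcases eq_or_ne x 0 with rfl | hx
  · simp
  have hx' : ‖x‖ ≠ 0 := norm_ne_zero_iff.2 hx
  have hv : Orthonormal ℝ (fun _ : Fin 1 => ‖x‖⁻¹ • x) := by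
    refine ⟨fun _ => ?_, fun i j hij => absurd (Subsingleton.elim i j) hij⟩
    rw [norm_smul, norm_inv, norm_norm, inv_mul_cancel₀ hx']
  have h := hC 1 _ hv
  simp only [map_smul, norm_smul, norm_inv, norm_norm, Finset.univ_unique, Finset.sum_singleton]
    at h
  have h2 := Real.le_sqrt_of_sq_le h
  rwa [inv_mul_le_iff₀ (by positivity), mul_comm] at h2

/-- Off a suitable finite-dimensional subspace, a Hilbert–Schmidt map is small. -/
lemma exists_finiteDimensional_norm_le (hHS : IsHilbertSchmidt T) {ε : ℝ} (hε : 0 < ε) :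
    ∃ P : Submodule ℝ H, FiniteDimensional ℝ P ∧ ∀ u ∈ Pᗮ, ‖T u‖ ≤ ε * ‖u‖ := by
  obtain ⟨C, hC⟩ := hHS
  let A : Set ℝ := {r | ∃ (n : ℕ) (v : Fin n → H), Orthonormal ℝ v ∧ r = ∑ i, ‖T (v i)‖ ^ 2}
  have hA : BddAbove A := ⟨C, by rintro _ ⟨n, v, hv, rfl⟩; exact hC n v hv⟩
  have hne : A.Nonempty := ⟨_, 0, Fin.elim0, ⟨fun i => i.elim0, fun i => i.elim0⟩, rfl⟩
  -- The family comes within ε² of the supremum, so adjoining a unit vector orthogonal to it can add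
  -- less than ε².
  obtain ⟨_, ⟨n, v, hv, rfl⟩, hlt⟩ :=
    exists_lt_of_lt_csSup hne (sub_lt_self (sSup A) (pow_pos hε 2))
  refine ⟨Submodule.span ℝ (range v), FiniteDimensional.span_of_finite ℝ (finite_range v),
    fun u hu => ?_⟩
  rcases eq_or_ne u 0 with rfl | hu0
  · simp
  have hu' : ‖u‖ ≠ 0 := norm_ne_zero_iff.2 hu0
  have hvu : ∀ i, ⟪v i, u⟫_ℝ = 0 := fun i => hu _ (Submodule.subset_span (mem_range_self i))
  have hcons : Orthonormal ℝ (Fin.cons (‖u‖⁻¹ • u) v : Fin (n + 1) → H) := by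
    refine ⟨fun i => ?_, fun i j hij => ?_⟩
    · induction i using Fin.cases with
      | zero => rw [Fin.cons_zero, norm_smul, norm_inv, norm_norm, inv_mul_cancel₀ hu']
      | succ i => exact hv.1 i
    · induction i using Fin.cases with
      | zero =>
        induction j using Fin.cases with
        | zero => exact absurd rfl hij
        | succ j => simp [inner_smul_left, real_inner_comm (v j) u, hvu j]
      | succ i =>
        induction j using Fin.cases with
        | zero => simp [inner_smul_right, hvu i]
        | succ j => exact hv.2 fun h => hij (congrArg Fin.succ h)
  have hle := le_csSup hA ⟨n + 1, _, hcons, rfl⟩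
  rw [Fin.sum_univ_succ] at hle
  simp only [Fin.cons_zero, Fin.cons_succ, map_smul, norm_smul, norm_inv, norm_norm] at hle
  have h2 : ‖u‖⁻¹ * ‖T u‖ ≤ ε := (sq_lt_sq₀ (by positivity) hε.le).1 (by linarith) |>.le
  rwa [inv_mul_le_iff₀ (by positivity), mul_comm] at h2

/-- A norm limit of the finite-rank maps T ∘ P, with P the projections onto the subspaces found
above. -/
lemma isCompactOperator [CompleteSpace H] (hHS : IsHilbertSchmidt T) : IsCompactOperator T := by
  obtain ⟨C, hC⟩ := hHS.exists_norm_le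
  let T' : H →L[ℝ] H := T.mkContinuous C hC
  suffices h : IsCompactOperator T' from h
  have hcl : IsClosed {f : H →L[ℝ] H | IsCompactOperator f} := isClosed_setOfPred_isCompactOperator
  refine hcl.closure_subset (Metric.mem_closure_iff.2 fun ε hε => ?_)
  obtain ⟨P, hP, hsmall⟩ := hHS.exists_finiteDimensional_norm_le (half_pos hε)
  refine ⟨T'.comp P.starProjection, ?_, ?_⟩
  · have hid : IsCompactOperator (id : P → P) := isCompactOperator_id
    exact (hid.comp_clm P.orthogonalProjectionOnto).continuous_comp
      (g := T'.comp P.subtypeL) (T'.comp P.subtypeL).continuous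
  · rw [dist_eq_norm]
    refine lt_of_le_of_lt (ContinuousLinearMap.opNorm_le_bound _ (half_pos hε).le fun x => ?_)
      (half_lt_self hε)
    have hx : (T' - T'.comp P.starProjection) x = T (x - P.starProjection x) := by
      simp [T']
    rw [hx]
    refine (hsmall _ (Submodule.sub_starProjection_mem_orthogonal x)).trans ?_
    gcongr
    rw [← P.starProjection_orthogonal_val]
    exact Pᗮ.norm_starProjection_apply_le x

/-- A vector of this space orthogonal to P satisfies t‖x‖² ≤ ⟨Tx, x⟩ ≤ (t/2)‖x‖², hence vanishes; so
projection to P is injective. -/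
lemma finiteDimensional_spectralSubspace (hHS : IsHilbertSchmidt T) (hT : T.IsSymmetric) {t : ℝ}
    (ht : 0 < t) : FiniteDimensional ℝ (spectralSubspace T (Ici t)) := by
  obtain ⟨P, hP, hsmall⟩ := hHS.exists_finiteDimensional_norm_le (half_pos ht)
  let f : spectralSubspace T (Ici t) →ₗ[ℝ] P :=
    P.orthogonalProjectionOnto.toLinearMap.comp (spectralSubspace T (Ici t)).subtype
  refine FiniteDimensional.of_injective f ((injective_iff_map_eq_zero _).2 fun x hx => ?_)
  have hx' : (x : H) ∈ Pᗮ := P.orthogonalProjectionOnto_eq_zero_iff.1 hx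
  have h1 := le_inner_of_mem_spectralSubspace_Ici hT x.2
  have h2 := (real_inner_le_norm (T x) x).trans
    (mul_le_mul_of_nonneg_right (hsmall _ hx') (norm_nonneg _))
  by_contra hne
  have h3 : 0 < ‖(x : H)‖ := norm_pos_iff.2 fun h => hne (Subtype.ext h)
  nlinarith [mul_pos ht (pow_pos h3 2)]

lemma finite_setOf_hasEigenvalue (hHS : IsHilbertSchmidt T) (hT : T.IsSymmetric) {t : ℝ}
    (ht : 0 < t) : {μ | t ≤ μ ∧ Module.End.HasEigenvalue T μ}.Finite := by
  have := hHS.finiteDimensional_spectralSubspace hT ht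
  choose v hv using fun μ : {μ | t ≤ μ ∧ Module.End.HasEigenvalue T μ} =>
    μ.2.2.exists_hasEigenvector
  have hli := Module.End.eigenvectors_linearIndependent' T _ Subtype.coe_injective v hv
  let w : {μ | t ≤ μ ∧ Module.End.HasEigenvalue T μ} → spectralSubspace T (Ici t) := fun μ =>
    ⟨v μ, Submodule.mem_iSup_of_mem μ.1 (Submodule.mem_iSup_of_mem μ.2.1 (hv μ).1)⟩
  have hw : LinearIndependent ℝ w :=
    LinearIndependent.of_comp (spectralSubspace T (Ici t)).subtype hli
  exact Set.finite_coe_iff.1 hw.finite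

/-- The quadratic form is at most `t ‖x‖²` orthogonally to the eigenvectors with eigenvalue at
least `t`. -/
lemma inner_le_of_mem_orthogonal [CompleteSpace H] (hHS : IsHilbertSchmidt T)
    (hT : T.IsSymmetric) {t : ℝ} {x : H} (hx : x ∈ (spectralSubspace T (Ici t))ᗮ) :
    ⟪T x, x⟫_ℝ ≤ t * ‖x‖ ^ 2 := by
  obtain ⟨C, hC⟩ := hHS.exists_norm_le
  let T' : H →L[ℝ] H := T.mkContinuous C hC
  set D := spectralSubspace T (Iio t)
  set E := spectralSubspace T (Ici t)
  have hDE : D ≤ Eᗮ := by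
    refine Submodule.isOrtho_iff_le.1 ?_
    simp only [D, E, spectralSubspace, Submodule.isOrtho_iSup_left, Submodule.isOrtho_iSup_right]
    intro μ hμ ν hν
    exact hT.orthogonalFamily_eigenspaces.isOrtho fun h =>
      absurd (mem_Iio.1 hν) (not_lt.2 (h ▸ mem_Ici.1 hμ))
  have htop : (⨆ μ, Module.End.eigenspace T μ)ᗮ = ⊥ :=
    ContinuousLinearMap.orthogonalComplement_iSup_eigenspaces_eq_bot (T := T')
      hHS.isCompactOperator hT
  have hcl : D.topologicalClosure ≤ Eᗮ :=
    Submodule.topologicalClosure_minimal _ hDE (Submodule.isClosed_orthogonal _)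
  have : CompleteSpace D.topologicalClosure :=
    D.isClosed_topologicalClosure.completeSpace_coe
  have hxD : x ∈ D.topologicalClosure := by
    -- The defect of x from the closure of D is orthogonal to every eigenspace: below t because
    -- these lie in D, from t on because x and D are orthogonal to E. By the spectral theorem it is
    -- zero.
    have h0 : x - D.topologicalClosure.starProjection x ∈ (⨆ μ, Module.End.eigenspace T μ)ᗮ := by
      rw [← Submodule.iInf_orthogonal, Submodule.mem_iInf]
      intro μ
      rcases lt_or_ge μ t with hμ | hμ
      · have hle : Module.End.eigenspace T μ ≤ D.topologicalClosure :=
          (le_biSup (fun μ => Module.End.eigenspace T μ) (mem_Iio.2 hμ)).trans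
            D.le_topologicalClosure
        exact Submodule.orthogonal_le hle (Submodule.sub_starProjection_mem_orthogonal x)
      · have hle : Module.End.eigenspace T μ ≤ E :=
          le_biSup (fun μ => Module.End.eigenspace T μ) (mem_Ici.2 hμ)
        exact Submodule.orthogonal_le hle
          (Submodule.sub_mem _ hx (hcl (Submodule.starProjection_apply_mem _ x)))
    rw [htop, Submodule.mem_bot, sub_eq_zero] at h0
    rw [h0]
    exact Submodule.starProjection_apply_mem _ x
  have hclosed : IsClosed {y : H | ⟪T' y, y⟫_ℝ ≤ t * ‖y‖ ^ 2} :=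
    isClosed_le (by fun_prop) (by fun_prop)
  exact closure_minimal (s := (D : Set H))
    (fun y hy => inner_le_of_mem_spectralSubspace_Iio hT hy) hclosed hxD

/-- Variational lower bound for the number of eigenvalues that are at least `t`. -/
lemma rank_le_rank_spectralSubspace [CompleteSpace H] (hHS : IsHilbertSchmidt T)
    (hT : T.IsSymmetric) {t : ℝ} (ht : 0 < t) {V : Type} [AddCommGroup V] [Module ℝ V]
    (J : V →ₗ[ℝ] H) (hJ : ∀ v ≠ 0, t * ‖J v‖ ^ 2 < ⟪T (J v), J v⟫_ℝ) :
    Module.rank ℝ V ≤ Module.rank ℝ (spectralSubspace T (Ici t)) := by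
  have := hHS.finiteDimensional_spectralSubspace hT ht
  -- A nonzero v killed by the projection would have J v orthogonal to the span, where the form is
  -- at most t‖J v‖².
  let f : V →ₗ[ℝ] spectralSubspace T (Ici t) :=
    (spectralSubspace T (Ici t)).orthogonalProjectionOnto.toLinearMap.comp J
  refine LinearMap.rank_le_of_injective f ((injective_iff_map_eq_zero _).2 fun v hv => ?_)
  by_contra hne
  have h := hHS.inner_le_of_mem_orthogonal hT
    ((spectralSubspace T (Ici t)).orthogonalProjectionOnto_eq_zero_iff.1 hv)
  exact absurd h (not_le.2 (hJ v hne))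

/-- Without this bound the supremum defining `kthEigenvalue` could be the default value 0. -/
lemma bddAbove_setOf_lt_rank (hHS : IsHilbertSchmidt T) (hT : T.IsSymmetric) (k : ℕ) :
    BddAbove {t : ℝ | (k : Cardinal) < Module.rank ℝ (spectralSubspace T (Ici t))} := by
  obtain ⟨C, hC⟩ := hHS.exists_norm_le
  refine ⟨C, fun t ht => ?_⟩
  obtain ⟨x, hx⟩ := rank_pos_iff_exists_ne_zero.1 ((zero_le).trans_lt ht)
  have h1 := le_inner_of_mem_spectralSubspace_Ici hT x.2
  have h2 := (real_inner_le_norm (T x) x).trans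
    (mul_le_mul_of_nonneg_right (hC x) (norm_nonneg _))
  have h3 : 0 < ‖(x : H)‖ := norm_pos_iff.2 fun h => hx (Subtype.ext h)
  have h4 : t * ‖(x : H)‖ ^ 2 ≤ C * ‖(x : H)‖ ^ 2 := by nlinarith
  exact le_of_mul_le_mul_right h4 (pow_pos h3 2)

/-- If more than `k` eigenvalues are at least some positive number, then the eigenvalue of index
`k` exists. -/
lemma isKthEigenvalue_kthEigenvalue (hHS : IsHilbertSchmidt T) (hT : T.IsSymmetric) {k : ℕ}
    {m : ℝ} (hm : 0 < m)
    (hk : (k : Cardinal) < Module.rank ℝ (spectralSubspace T (Ici m))) :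
    IsKthEigenvalue T k (kthEigenvalue T k) := by
  have hbdd := hHS.bddAbove_setOf_lt_rank hT k
  set s := kthEigenvalue T k with hs
  have hms : m ≤ s := le_csSup hbdd hk
  have hs0 : 0 < s / 2 := by linarith
  have hF := hHS.finite_setOf_hasEigenvalue hT hs0
  constructor
  -- Only finitely many eigenvalues are ≥ s/2, so some t > s lies below all those exceeding s. If
  -- more than k exceeded s, t would belong to the set whose supremum is s.
  · have hev : ∀ᶠ t in nhdsWithin s (Ioi s),
        ∀ μ ∈ {μ | s / 2 ≤ μ ∧ Module.End.HasEigenvalue T μ}, s < μ → t ≤ μ := by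
      refine (Filter.eventually_all_finite hF).2 fun μ _ => ?_
      by_cases hμ : s < μ
      · filter_upwards [Ioo_mem_nhdsGT hμ] with t ht _ using ht.2.le
      · exact Filter.Eventually.of_forall fun t h => absurd h hμ
    obtain ⟨t, ht, hst⟩ := (hev.and self_mem_nhdsWithin).exists
    by_contra! hlt
    have hle : spectralSubspace T (Ioi s) ≤ spectralSubspace T (Ici t) :=
      spectralSubspace_le_of_hasEigenvalue fun μ hμ he =>
        ht μ ⟨by linarith [mem_Ioi.1 hμ], he⟩ hμ
    have : t ≤ s := le_csSup hbdd (hlt.trans_le (Submodule.rank_mono hle))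
    exact absurd hst (not_lt.2 this)
  -- Likewise some t < s leaves no eigenvalue in [t, s). Any r > t in the set then counts only
  -- eigenvalues ≥ s.
  · have hev : ∀ᶠ t in nhdsWithin s (Iio s),
        ∀ μ ∈ {μ | s / 2 ≤ μ ∧ Module.End.HasEigenvalue T μ}, μ < s → μ < t := by
      refine (Filter.eventually_all_finite hF).2 fun μ _ => ?_
      by_cases hμ : μ < s
      · filter_upwards [Ioo_mem_nhdsLT hμ] with t ht _ using ht.1
      · exact Filter.Eventually.of_forall fun t h => absurd h hμ
    have hlow : ∀ᶠ t in nhdsWithin s (Iio s), s / 2 ≤ t := by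
      filter_upwards [Ioo_mem_nhdsLT (show s / 2 < s by linarith)] with t ht using ht.1.le
    obtain ⟨t, ⟨ht, hst⟩, hlt⟩ := ((hev.and hlow).and self_mem_nhdsWithin).exists
    obtain ⟨r, hr, htr⟩ := exists_lt_of_lt_csSup ⟨m, hk⟩ (show t < sSup _ from hlt)
    refine hr.trans_le (Submodule.rank_mono (spectralSubspace_le_of_hasEigenvalue
      fun μ hμ he => ?_))
    have htμ : t < μ := htr.trans_le hμ
    by_contra hμs
    exact absurd (ht μ ⟨hst.trans htμ.le, he⟩ (not_le.1 hμs)) (not_lt.2 htμ.le)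

end IsHilbertSchmidt

/-- Positivity of the quadratic form on the span of a family whose Gram matrix with respect to
the form is diagonally dominant. -/
lemma exists_pos_lt_inner_of_dominant (T : H →ₗ[ℝ] H) {n : ℕ} (v : Fin n → H) {M e : ℝ}
    (hM : 0 ≤ M) (he : 0 < e) (hdiag : ∀ i, M * n + e ≤ ⟪T (v i), v i⟫_ℝ)
    (hoff : ∀ i j, i ≠ j → |⟪T (v i), v j⟫_ℝ| ≤ M) :
    ∃ t > 0, ∀ c : Fin n → ℝ, c ≠ 0 →
      t * ‖Fintype.linearCombination ℝ v c‖ ^ 2 <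
        ⟪T (Fintype.linearCombination ℝ v c), Fintype.linearCombination ℝ v c⟫_ℝ := by
  set B : ℝ := ∑ i, ‖v i‖ ^ 2
  have hB : 0 ≤ B := Finset.sum_nonneg fun i _ => sq_nonneg _
  -- With S = ∑ cᵢ², the form is at least e S and the squared norm at most B S, so any t with t B <
  -- e serves; B + 1 avoids division by zero.
  refine ⟨e / (2 * (B + 1)), by positivity, fun c hc => ?_⟩
  set S : ℝ := ∑ i, c i ^ 2 with hS
  have hS0 : 0 < S := by
    obtain ⟨i, hi⟩ := Function.ne_iff.1 hc
    exact Finset.sum_pos' (fun i _ => sq_nonneg _) ⟨i, Finset.mem_univ i, sq_pos_of_ne_zero hi⟩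
  have hform : e * S ≤
      ⟪T (Fintype.linearCombination ℝ v c), Fintype.linearCombination ℝ v c⟫_ℝ := by
    have hexp : ⟪T (Fintype.linearCombination ℝ v c), Fintype.linearCombination ℝ v c⟫_ℝ =
        ∑ i, ∑ j, c i * c j * ⟪T (v i), v j⟫_ℝ := by
      simp only [Fintype.linearCombination_apply, map_sum, map_smul, sum_inner, inner_sum,
        inner_smul_left, inner_smul_right, RCLike.conj_to_real, Finset.mul_sum]
      rw [Finset.sum_comm]
      exact Finset.sum_congr rfl fun i _ => Finset.sum_congr rfl fun j _ => by ring
    -- The subtracted terms, summed over all i and j, total M n S, exactly what the diagonal surplus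
    -- M n absorbs.
    have hterm : ∀ i j, (if i = j then (M * n + e) * c i ^ 2 else 0) - M * ((c i ^ 2 + c j ^ 2) / 2)
        ≤ c i * c j * ⟪T (v i), v j⟫_ℝ := by
      intro i j
      rcases eq_or_ne i j with rfl | hij
      · rw [if_pos rfl]
        nlinarith [mul_le_mul_of_nonneg_right (hdiag i) (sq_nonneg (c i)),
          mul_nonneg hM (sq_nonneg (c i))]
      · rw [if_neg hij]
        have h1 : |c i * c j * ⟪T (v i), v j⟫_ℝ| ≤ (c i ^ 2 + c j ^ 2) / 2 * M := by
          rw [abs_mul]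
          refine mul_le_mul ?_ (hoff i j hij) (abs_nonneg _) (by positivity)
          rw [abs_le]
          constructor <;> nlinarith [sq_nonneg (c i - c j), sq_nonneg (c i + c j)]
        linarith [(abs_le.1 h1).1]
    rw [hexp]
    refine le_trans (le_of_eq ?_)
      (Finset.sum_le_sum fun i _ => Finset.sum_le_sum fun j _ => hterm i j)
    simp only [Finset.sum_sub_distrib, Finset.sum_ite_eq, Finset.mem_univ, if_true,
      ← Finset.mul_sum, ← Finset.sum_div, Finset.sum_add_distrib, Finset.sum_const,
      Finset.card_univ, Fintype.card_fin, nsmul_eq_mul, ← hS]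
    ring
  have hnorm : ‖Fintype.linearCombination ℝ v c‖ ^ 2 ≤ S * B := by
    have h1 : ‖Fintype.linearCombination ℝ v c‖ ≤ ∑ i, |c i| * ‖v i‖ := by
      rw [Fintype.linearCombination_apply]
      exact (norm_sum_le _ _).trans (le_of_eq (by simp [norm_smul]))
    calc ‖Fintype.linearCombination ℝ v c‖ ^ 2 ≤ (∑ i, |c i| * ‖v i‖) ^ 2 := by gcongr
      _ ≤ (∑ i, |c i| ^ 2) * ∑ i, ‖v i‖ ^ 2 := Finset.sum_mul_sq_le_sq_mul_sq _ _ _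
      _ = S * B := by simp only [sq_abs, hS, B]
  calc e / (2 * (B + 1)) * ‖Fintype.linearCombination ℝ v c‖ ^ 2
      ≤ e / (2 * (B + 1)) * (S * B) := by gcongr
    _ < e * S := by
      rw [div_mul_eq_mul_div, div_lt_iff₀ (by positivity)]
      nlinarith [mul_pos he hS0, mul_nonneg (mul_pos he hS0).le hB]
    _ ≤ _ := hform

end hilbertSchmidt
-- The Newtonian operator is symmetric and Hilbert–Schmidt
section operator

variable {d : ℕ} {Ω Ω₁ Ω₂ : Set (EuclideanSpace ℝ (Fin d))}

open scoped InnerProductSpace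

lemma isFiniteMeasure_restrict (hΩ : Bornology.IsBounded Ω) :
    IsFiniteMeasure ((volume : Measure (EuclideanSpace ℝ (Fin d))).restrict Ω) :=
  ⟨by simpa using hΩ.measure_lt_top⟩

lemma memLp_kernel {R : ℝ} (hR : Ω ⊆ ball 0 R) {x : EuclideanSpace ℝ (Fin d)}
    (hx : x ∈ ball 0 R) :
    MemLp (fun y => fundamentalSolution (x - y)) 2 (volume.restrict Ω) := by
  have hm : AEStronglyMeasurable (fun y => fundamentalSolution (x - y)) (volume.restrict Ω) :=
    (measurable_fundamentalSolution.comp (measurable_const.sub measurable_id)).aestronglyMeasurable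
  exact (memLp_two_iff_integrable_sq hm).2 (integrable_kernel_sq hR hx).1

lemma memLp_kernel_prod (hΩ : Bornology.IsBounded Ω) :
    MemLp (fun p : EuclideanSpace ℝ (Fin d) × EuclideanSpace ℝ (Fin d) =>
      fundamentalSolution (p.1 - p.2)) 2 ((volume.restrict Ω).prod (volume.restrict Ω)) := by
  obtain ⟨R, hR⟩ := hΩ.subset_ball 0
  have := isFiniteMeasure_restrict hΩ
  have hm : Measurable (fun p : EuclideanSpace ℝ (Fin d) × EuclideanSpace ℝ (Fin d) =>
      fundamentalSolution (p.1 - p.2)) :=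
    measurable_fundamentalSolution.comp (measurable_fst.sub measurable_snd)
  rw [memLp_two_iff_integrable_sq hm.aestronglyMeasurable,
    integrable_prod_iff (hm.pow_const 2).aestronglyMeasurable]
  refine ⟨?_, ?_⟩
  · filter_upwards [ae_mem_ball hR] with x hx using (integrable_kernel_sq hR hx).1
  · refine Integrable.of_bound ?_
      (∫ z in ball (0 : EuclideanSpace ℝ (Fin d)) (2 * R), fundamentalSolution z ^ 2) ?_
    · exact ((hm.pow_const 2).norm.stronglyMeasurable.integral_prod_right
        (ν := volume.restrict Ω)).aestronglyMeasurable
    · filter_upwards [ae_mem_ball hR] with x hx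
      simp only [norm_pow, Real.norm_eq_abs, sq_abs]
      rw [abs_of_nonneg (integral_nonneg fun y => sq_nonneg _)]
      exact (integrable_kernel_sq hR hx).2

lemma inner_eq_integral_mul (f g : L2 Ω) : ⟪f, g⟫_ℝ = ∫ x in Ω, f x * g x := by
  rw [L2.inner_def]
  exact integral_congr_ae (Filter.Eventually.of_forall fun x => by simp [mul_comm])

lemma inner_newtonianOperator (hΩ : Bornology.IsBounded Ω) (f g : L2 Ω) :
    ⟪newtonianOperator Ω hΩ f, g⟫_ℝ = ∫ x in Ω, potential Ω f x * g x := by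
  rw [inner_eq_integral_mul]
  refine integral_congr_ae ?_
  filter_upwards [newtonianOperator_apply hΩ f] with x hx
  rw [hx, potential]

lemma fundamentalSolution_neg (z : EuclideanSpace ℝ (Fin d)) :
    fundamentalSolution (-z) = fundamentalSolution z := by
  simp [fundamentalSolution]

/-- Fubini and evenness of the kernel; the kernel and g(x) f(y) are both square integrable on the
product, so their product is integrable. -/
lemma isSymmetric_newtonianOperator (hΩ : Bornology.IsBounded Ω) :
    (newtonianOperator Ω hΩ).IsSymmetric := by
  intro f g
  have := isFiniteMeasure_restrict hΩ
  rw [real_inner_comm (newtonianOperator Ω hΩ g) f, inner_newtonianOperator,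
    inner_newtonianOperator]
  have hfg : MemLp (fun p : EuclideanSpace ℝ (Fin d) × EuclideanSpace ℝ (Fin d) =>
      g p.1 * f p.2) 2 ((volume.restrict Ω).prod (volume.restrict Ω)) := by
    refine (memLp_two_iff_integrable_sq
      ((Lp.aestronglyMeasurable g).comp_fst.mul (Lp.aestronglyMeasurable f).comp_snd)).2 ?_
    simp only [Pi.mul_apply, mul_pow]
    exact (Lp.memLp g).integrable_sq.mul_prod (Lp.memLp f).integrable_sq
  have hint := (memLp_kernel_prod hΩ).integrable_mul hfg
  have hswap := integral_integral_swap
    (f := fun x y => fundamentalSolution (x - y) * (g x * f y)) hint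
  simp only [potential, ← integral_mul_const]
  calc ∫ x in Ω, ∫ y in Ω, fundamentalSolution (x - y) * f y * g x
      = ∫ x in Ω, ∫ y in Ω, fundamentalSolution (x - y) * (g x * f y) := by
        simp only [mul_assoc, mul_comm]
    _ = _ := by
        rw [hswap]
        refine integral_congr_ae (Filter.Eventually.of_forall fun y =>
          integral_congr_ae (Filter.Eventually.of_forall fun x => ?_))
        simp only
        rw [← neg_sub y x, fundamentalSolution_neg, mul_assoc]

/-- At almost every x ∈ Ω the values of the potentials of the vᵢ are the inner products of vᵢ with y
↦ φ₀(x, y). Bessel's inequality bounds their sum of squares uniformly in x, and Ω has finite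
measure. -/
lemma isHilbertSchmidt_newtonianOperator (hΩ : Bornology.IsBounded Ω) :
    IsHilbertSchmidt (newtonianOperator Ω hΩ) := by
  obtain ⟨R, hR⟩ := hΩ.subset_ball 0
  have := isFiniteMeasure_restrict hΩ
  refine ⟨∫ _ in Ω, ∫ z in ball (0 : EuclideanSpace ℝ (Fin d)) (2 * R),
    fundamentalSolution z ^ 2, fun n v hv => ?_⟩
  have hsq : ∀ i, ‖newtonianOperator Ω hΩ (v i)‖ ^ 2 = ∫ x in Ω, potential Ω (v i) x ^ 2 := by
    intro i
    rw [← real_inner_self_eq_norm_sq, inner_eq_integral_mul]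
    refine integral_congr_ae ?_
    filter_upwards [newtonianOperator_apply hΩ (v i)] with x hx
    rw [hx, potential, sq]
  have hi : ∀ i ∈ Finset.univ, Integrable (fun x => potential Ω (v i) x ^ 2) (volume.restrict Ω) :=
    fun i _ => (memLp_potential hΩ (v i)).integrable_sq
  simp only [hsq]
  rw [← integral_finsetSum _ hi]
  refine integral_mono_ae (integrable_finsetSum _ hi) (integrable_const _) ?_
  filter_upwards [ae_mem_ball hR] with x hx
  have hk := memLp_kernel hR hx
  have hpot : ∀ i, potential Ω (v i) x = ⟪v i, hk.toLp⟫_ℝ := by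
    intro i
    rw [inner_eq_integral_mul, potential]
    refine integral_congr_ae ?_
    filter_upwards [hk.coeFn_toLp] with y hy
    rw [hy, mul_comm]
  calc ∑ i, potential Ω (v i) x ^ 2 = ∑ i, ‖⟪v i, hk.toLp⟫_ℝ‖ ^ 2 := by
        simp only [hpot, Real.norm_eq_abs, sq_abs]
    _ ≤ ‖hk.toLp‖ ^ 2 := hv.sum_inner_products_le _
    _ = ∫ y in Ω, fundamentalSolution (x - y) ^ 2 := by
        rw [← real_inner_self_eq_norm_sq, inner_eq_integral_mul]
        refine integral_congr_ae ?_
        filter_upwards [hk.coeFn_toLp] with y hy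
        rw [hy, sq]
    _ ≤ _ := (integrable_kernel_sq hR hx).2

/-! ### Extension by zero -/

lemma memLp_indicator (hsub : Ω₁ ⊆ Ω₂) (hm : MeasurableSet Ω₁) (f : L2 Ω₁) :
    MemLp (Ω₁.indicator f) 2 (volume.restrict Ω₂) := by
  rw [memLp_indicator_iff_restrict hm, Measure.restrict_restrict_of_subset hsub]
  exact Lp.memLp f

/-- Extension by zero `L²(Ω₁) → L²(Ω₂)`. -/
def extendByZero (hsub : Ω₁ ⊆ Ω₂) (hm : MeasurableSet Ω₁) : L2 Ω₁ →ₗ[ℝ] L2 Ω₂ where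
  toFun f := (memLp_indicator hsub hm f).toLp (Ω₁.indicator f)
  map_add' f g := by
    rw [← MemLp.toLp_add, MemLp.toLp_eq_toLp_iff, ← indicator_add']
    refine ae_restrict_of_ae ?_
    filter_upwards [(ae_restrict_iff' hm).1 (Lp.coeFn_add f g)] with x hx
    by_cases h : x ∈ Ω₁
    · simp only [indicator_of_mem h, hx h]
    · simp only [indicator_of_notMem h]
  map_smul' c f := by
    rw [RingHom.id_apply, ← MemLp.toLp_const_smul, MemLp.toLp_eq_toLp_iff]
    refine ae_restrict_of_ae ?_
    filter_upwards [(ae_restrict_iff' hm).1 (Lp.coeFn_smul c f)] with x hx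
    by_cases h : x ∈ Ω₁
    · simp only [indicator_of_mem h, hx h, Pi.smul_apply]
    · simp only [indicator_of_notMem h, Pi.smul_apply, smul_zero]

lemma setIntegral_mul_extendByZero (hsub : Ω₁ ⊆ Ω₂) (hm : MeasurableSet Ω₁)
    (F : EuclideanSpace ℝ (Fin d) → ℝ) (f : L2 Ω₁) :
    ∫ x in Ω₂, F x * extendByZero hsub hm f x = ∫ x in Ω₁, F x * f x := by
  calc ∫ x in Ω₂, F x * extendByZero hsub hm f x
      = ∫ x in Ω₂, Ω₁.indicator (fun x => F x * f x) x := by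
        refine integral_congr_ae ?_
        filter_upwards [(memLp_indicator hsub hm f).coeFn_toLp] with x hx
        rw [indicator_mul_right, ← hx]
        rfl
    _ = ∫ x in Ω₁, F x * f x := by
        rw [integral_indicator hm, Measure.restrict_restrict_of_subset hsub]

/-- An identity at every point of ℝᵈ, so it may be used inside integrals over either domain. -/
lemma potential_extendByZero (hsub : Ω₁ ⊆ Ω₂) (hm : MeasurableSet Ω₁) (f : L2 Ω₁) :
    potential Ω₂ (extendByZero hsub hm f) = potential Ω₁ f :=
  funext fun _ => setIntegral_mul_extendByZero hsub hm _ f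

lemma inner_newtonianOperator_extendByZero (hsub : Ω₁ ⊆ Ω₂) (hm : MeasurableSet Ω₁)
    (h₁ : Bornology.IsBounded Ω₁) (h₂ : Bornology.IsBounded Ω₂) (f : L2 Ω₁) :
    ⟪newtonianOperator Ω₂ h₂ (extendByZero hsub hm f), extendByZero hsub hm f⟫_ℝ =
      ⟪newtonianOperator Ω₁ h₁ f, f⟫_ℝ := by
  rw [inner_newtonianOperator, inner_newtonianOperator, setIntegral_mul_extendByZero,
    potential_extendByZero]

lemma norm_extendByZero (hsub : Ω₁ ⊆ Ω₂) (hm : MeasurableSet Ω₁) (f : L2 Ω₁) :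
    ‖extendByZero hsub hm f‖ = ‖f‖ := by
  rw [← sq_eq_sq₀ (norm_nonneg _) (norm_nonneg _), ← real_inner_self_eq_norm_sq,
    ← real_inner_self_eq_norm_sq, inner_eq_integral_mul, setIntegral_mul_extendByZero,
    inner_eq_integral_mul]
  refine integral_congr_ae ?_
  filter_upwards [ae_restrict_mem hm, ae_restrict_of_ae_restrict_of_subset hsub
    (memLp_indicator hsub hm f).coeFn_toLp] with x hx h
  have : extendByZero hsub hm f x = f x := by
    rw [← indicator_of_mem hx f, ← h]
    rfl
  simp only [this]

end operator
-- Test functions on small balls, and comparison of domains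
section testFunctions

variable {d : ℕ} {Ω Ω₁ Ω₂ : Set (EuclideanSpace ℝ (Fin d))}

open scoped InnerProductSpace

/-- The fundamental solution tends to `+∞` at its singularity. -/
lemma exists_le_fundamentalSolution (hd : d = 2 ∨ d = 3) (A : ℝ) :
    ∃ ε > 0, ∀ z : EuclideanSpace ℝ (Fin d), z ≠ 0 → ‖z‖ ≤ ε → A ≤ fundamentalSolution z := by
  have hpi := Real.pi_pos
  rcases hd with rfl | rfl
  · refine ⟨Real.exp (-(2 * Real.pi * A)), Real.exp_pos _, fun z hz hle => ?_⟩
    have hlog := (Real.log_le_iff_le_exp (norm_pos_iff.2 hz)).2 hle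
    rw [fundamentalSolution, if_pos rfl, div_mul_eq_mul_div, le_div_iff₀ (by positivity)]
    linarith
  · refine ⟨1 / (4 * Real.pi * (|A| + 1)), by positivity, fun z hz hle => ?_⟩
    have hz' := norm_pos_iff.2 hz
    rw [fundamentalSolution, if_neg (by norm_num), if_pos rfl, le_div_iff₀ (by positivity)]
    rw [le_div_iff₀ (by positivity)] at hle
    nlinarith [le_abs_self A, mul_pos hpi hz']

lemma continuousAt_fundamentalSolution {z : EuclideanSpace ℝ (Fin d)} (hz : z ≠ 0) :
    ContinuousAt fundamentalSolution z := by
  have hz' := norm_ne_zero_iff.2 hz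
  have hpi := Real.pi_ne_zero
  unfold fundamentalSolution
  split_ifs
  · exact continuousAt_const.mul (continuous_norm.continuousAt.log hz')
  · exact continuousAt_const.div (continuousAt_const.mul continuous_norm.continuousAt)
      (by positivity)
  · exact continuousAt_const

lemma exists_abs_fundamentalSolution_le {δ : ℝ} (hδ : 0 < δ) (R : ℝ) :
    ∃ M : ℝ, 0 ≤ M ∧ ∀ z : EuclideanSpace ℝ (Fin d), δ ≤ ‖z‖ → ‖z‖ ≤ R →
      |fundamentalSolution z| ≤ M := by
  have hK : IsCompact (closedBall (0 : EuclideanSpace ℝ (Fin d)) R \ ball 0 δ) :=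
    (isCompact_closedBall 0 R).diff isOpen_ball
  obtain ⟨M, hM⟩ := hK.exists_bound_of_continuousOn (f := fundamentalSolution) fun z hz =>
    (continuousAt_fundamentalSolution (by
      rintro rfl
      exact hz.2 (mem_ball_self hδ))).continuousWithinAt
  -- When the annulus is empty the bound M may be negative, hence the maximum with 0.
  exact ⟨max M 0, le_max_right _ _, fun z h1 h2 => (hM z ⟨mem_closedBall_zero_iff.2 h2, fun h =>
    absurd (mem_ball_zero_iff.1 h) (not_lt.2 h1)⟩).trans (le_max_left _ _)⟩

/-- Arbitrarily many well separated balls in a nonempty open set. -/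
lemma exists_separated_balls (hd : d ≠ 0) (hne : Ω.Nonempty) (hopen : IsOpen Ω) (n : ℕ) :
    ∃ (p : Fin n → EuclideanSpace ℝ (Fin d)) (δ : ℝ), 0 < δ ∧ (∀ i, ball (p i) δ ⊆ Ω) ∧
      ∀ i j, i ≠ j → 3 * δ ≤ dist (p i) (p j) := by
  have : Nonempty (Fin d) := ⟨⟨0, Nat.pos_of_ne_zero hd⟩⟩
  -- In positive dimension finite sets are null, while nonempty open sets are not.
  have hinf : Ω.Infinite := by
    intro hfin
    exact (hopen.measure_pos volume hne).ne' (hfin.measure_zero volume)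
  let p : Fin n → EuclideanSpace ℝ (Fin d) := fun i => hinf.natEmbedding Ω i
  have hpΩ : ∀ i, p i ∈ Ω := fun i => (hinf.natEmbedding Ω i).2
  have hp : Function.Injective p := fun i j h =>
    Fin.ext ((hinf.natEmbedding Ω).injective (Subtype.ext h))
  have h1 : ∀ᶠ δ in nhdsWithin (0 : ℝ) (Ioi 0), ∀ i, ball (p i) δ ⊆ Ω := by
    refine Filter.eventually_all.2 fun i => ?_
    obtain ⟨δ, hδ, hsub⟩ := Metric.isOpen_iff.1 hopen (p i) (hpΩ i)
    filter_upwards [Ioo_mem_nhdsGT hδ] with r hr using (ball_subset_ball hr.2.le).trans hsub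
  -- Centres 3δ apart keep points of distinct δ-balls at distance at least δ, away from the
  -- singularity.
  have h2 : ∀ᶠ δ in nhdsWithin (0 : ℝ) (Ioi 0), ∀ i j, i ≠ j → 3 * δ ≤ dist (p i) (p j) := by
    refine Filter.eventually_all.2 fun i => Filter.eventually_all.2 fun j => ?_
    by_cases hij : i = j
    · exact Filter.Eventually.of_forall fun _ h => absurd hij h
    · have hpos : 0 < dist (p i) (p j) / 3 := div_pos (dist_pos.2 (hp.ne hij)) (by norm_num)
      filter_upwards [Ioo_mem_nhdsGT hpos] with r hr _
      linarith [hr.2]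
  obtain ⟨δ, ⟨hδ1, hδ2⟩, hδ⟩ := ((h1.and h2).and self_mem_nhdsWithin).exists
  exact ⟨p, δ, hδ, hδ1, hδ2⟩

/-- The indicator function of a ball, as an element of `L²(Ω)`. -/
def ballIndicator (hΩ : Bornology.IsBounded Ω) (p : EuclideanSpace ℝ (Fin d)) (r : ℝ) : L2 Ω :=
  have := isFiniteMeasure_restrict hΩ
  indicatorConstLp 2 (measurableSet_ball (x := p) (ε := r)) (measure_ne_top _ _) (1 : ℝ)

lemma setIntegral_mul_ballIndicator (hΩ : Bornology.IsBounded Ω) {p : EuclideanSpace ℝ (Fin d)}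
    {r : ℝ} (hsub : ball p r ⊆ Ω) (F : EuclideanSpace ℝ (Fin d) → ℝ) :
    ∫ x in Ω, F x * ballIndicator hΩ p r x = ∫ x in ball p r, F x := by
  have := isFiniteMeasure_restrict hΩ
  calc ∫ x in Ω, F x * ballIndicator hΩ p r x = ∫ x in Ω, (ball p r).indicator F x := by
        refine integral_congr_ae ?_
        filter_upwards [indicatorConstLp_coeFn (p := 2) (c := (1 : ℝ))
          (hs := measurableSet_ball (x := p) (ε := r))
          (hμs := measure_ne_top (volume.restrict Ω) _)] with x hx
        rw [ballIndicator, hx]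
        by_cases h : x ∈ ball p r <;> simp [h]
    _ = _ := by
        rw [integral_indicator measurableSet_ball, Measure.restrict_restrict_of_subset hsub]

lemma potential_ballIndicator (hΩ : Bornology.IsBounded Ω) {p : EuclideanSpace ℝ (Fin d)}
    {r : ℝ} (hsub : ball p r ⊆ Ω) (x : EuclideanSpace ℝ (Fin d)) :
    potential Ω (ballIndicator hΩ p r) x = ∫ y in ball p r, fundamentalSolution (x - y) :=
  setIntegral_mul_ballIndicator hΩ hsub _

lemma inner_newtonianOperator_ballIndicator (hΩ : Bornology.IsBounded Ω)
    {p q : EuclideanSpace ℝ (Fin d)} {r s : ℝ} (hp : ball p r ⊆ Ω) (hq : ball q s ⊆ Ω) :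
    ⟪newtonianOperator Ω hΩ (ballIndicator hΩ p r), ballIndicator hΩ q s⟫_ℝ =
      ∫ x in ball q s, ∫ y in ball p r, fundamentalSolution (x - y) := by
  rw [inner_newtonianOperator, setIntegral_mul_ballIndicator hΩ hq]
  simp only [potential_ballIndicator hΩ hp]

lemma le_inner_newtonianOperator_ballIndicator (hd : d ≠ 0) (hΩ : Bornology.IsBounded Ω)
    {p : EuclideanSpace ℝ (Fin d)} {r A : ℝ} (hp : ball p r ⊆ Ω)
    (hA : ∀ z : EuclideanSpace ℝ (Fin d), z ≠ 0 → ‖z‖ ≤ 2 * r → A ≤ fundamentalSolution z) :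
    A * volume.real (ball p r) ^ 2 ≤
      ⟪newtonianOperator Ω hΩ (ballIndicator hΩ p r), ballIndicator hΩ p r⟫_ℝ := by
  have : Nonempty (Fin d) := ⟨⟨0, Nat.pos_of_ne_zero hd⟩⟩
  have := isFiniteMeasure_restrict (isBounded_ball (x := p) (r := r))
  have := isFiniteMeasure_restrict hΩ
  obtain ⟨R, hR⟩ := hΩ.subset_ball 0
  have hpot : Integrable (fun x => ∫ y in ball p r, fundamentalSolution (x - y))
      (volume.restrict (ball p r)) := by
    have h := ((memLp_potential hΩ (ballIndicator hΩ p r)).integrable one_le_two)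
    simp only [funext (potential_ballIndicator hΩ hp)] at h
    exact h.mono_measure (Measure.restrict_mono hp le_rfl)
  rw [inner_newtonianOperator_ballIndicator hΩ hp hp]
  have hin : ∀ x ∈ ball p r,
      A * volume.real (ball p r) ≤ ∫ y in ball p r, fundamentalSolution (x - y) := by
    intro x hx
    have hk := (memLp_kernel (hp.trans hR) (hR (hp hx))).integrable one_le_two
    calc A * volume.real (ball p r) = ∫ _ in ball p r, A := by simp [mul_comm]
      _ ≤ _ := by
        refine integral_mono_ae (integrable_const _) hk ?_
        -- The point y = x, where the kernel has only a default value, is null.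
        filter_upwards [ae_restrict_mem measurableSet_ball,
          ae_restrict_of_ae (Measure.ae_ne volume x)] with y hy hyx
        refine hA _ (sub_ne_zero.2 (Ne.symm hyx)) ?_
        rw [← dist_eq_norm]
        have := dist_triangle_right x y p
        linarith [mem_ball.1 hx, mem_ball.1 hy]
  calc A * volume.real (ball p r) ^ 2 = ∫ _ in ball p r, A * volume.real (ball p r) := by
        rw [setIntegral_const, smul_eq_mul]
        ring
    _ ≤ _ := setIntegral_mono_on (integrable_const _) hpot measurableSet_ball hin

lemma abs_inner_newtonianOperator_ballIndicator_le (hΩ : Bornology.IsBounded Ω)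
    {p q : EuclideanSpace ℝ (Fin d)} {r s M : ℝ} (hp : ball p r ⊆ Ω) (hq : ball q s ⊆ Ω)
    (hM : ∀ x ∈ ball q s, ∀ y ∈ ball p r, |fundamentalSolution (x - y)| ≤ M) :
    |⟪newtonianOperator Ω hΩ (ballIndicator hΩ p r), ballIndicator hΩ q s⟫_ℝ| ≤
      M * volume.real (ball p r) * volume.real (ball q s) := by
  rw [inner_newtonianOperator_ballIndicator hΩ hp hq]
  simp only [← Real.norm_eq_abs] at hM ⊢
  exact norm_setIntegral_le_of_norm_le_const measure_ball_lt_top fun x hx =>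
    norm_setIntegral_le_of_norm_le_const measure_ball_lt_top (hM x hx)

/-- Infinitely many eigenvalues of the Newtonian potential operator are positive. -/
lemma exists_pos_lt_rank_spectralSubspace (hd : d = 2 ∨ d = 3) (hne : Ω.Nonempty)
    (hopen : IsOpen Ω) (hΩ : Bornology.IsBounded Ω) (k : ℕ) :
    ∃ t > 0, (k : Cardinal) <
      Module.rank ℝ (spectralSubspace (newtonianOperator Ω hΩ) (Ici t)) := by
  have hd0 : d ≠ 0 := by rcases hd with rfl | rfl <;> norm_num
  obtain ⟨R, hR⟩ := hΩ.subset_ball 0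
  obtain ⟨p, δ, hδ, hball, hsep⟩ := exists_separated_balls hd0 hne hopen (k + 1)
  obtain ⟨M, hM0, hM⟩ := exists_abs_fundamentalSolution_le (d := d) hδ (2 * R)
  -- M is fixed by the separation δ before the radius r ≤ δ is chosen, and remains valid for smaller
  -- balls. With b the volume of an r-ball, self-energies are at least (M b²)(k + 1) + b² and
  -- interactions at most M b²: diagonal dominance with e = b².
  obtain ⟨ε, hε, hA⟩ := exists_le_fundamentalSolution hd (M * (k + 1 : ℕ) + 1)
  set r := min δ (ε / 2)
  have hr : 0 < r := lt_min hδ (half_pos hε)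
  have hrδ : r ≤ δ := min_le_left _ _
  have hrε : 2 * r ≤ ε := by linarith [min_le_right δ (ε / 2)]
  have hsub : ∀ i, ball (p i) r ⊆ Ω := fun i => (ball_subset_ball hrδ).trans (hball i)
  set b := volume.real (ball (0 : EuclideanSpace ℝ (Fin d)) r)
  have hb : ∀ x : EuclideanSpace ℝ (Fin d), volume.real (ball x r) = b := fun x => by
    simp only [b, measureReal_def, Measure.addHaar_ball_center]
  have hb0 : 0 < b := ENNReal.toReal_pos (measure_ball_pos _ _ hr).ne' measure_ball_lt_top.ne
  obtain ⟨t, ht, hlt⟩ := exists_pos_lt_inner_of_dominant (newtonianOperator Ω hΩ)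
    (fun i => ballIndicator hΩ (p i) r) (M := M * b * b) (e := b ^ 2) (by positivity)
    (by positivity) (fun i => by
      have h := le_inner_newtonianOperator_ballIndicator hd0 hΩ (hsub i)
        fun z hz hle => hA z hz (hle.trans hrε)
      rw [hb] at h
      exact le_trans (le_of_eq (by ring)) h)
    (fun i j hij => by
      have h := abs_inner_newtonianOperator_ballIndicator_le hΩ (hsub i) (hsub j) (M := M)
        fun x hx y hy => ?_
      · rwa [hb, hb] at h
      · have hx' := mem_ball_zero_iff.1 (hR (hsub j hx))
        have hy' := mem_ball_zero_iff.1 (hR (hsub i hy))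
        refine hM _ ?_ (by linarith [norm_sub_le x y])
        rw [← dist_eq_norm]
        have h1 := hsep i j hij
        have h2 := dist_triangle4 (p i) y x (p j)
        rw [dist_comm (p i) y, dist_comm y x] at h2
        linarith [mem_ball.1 hx, mem_ball.1 hy])
  refine ⟨t, ht, ?_⟩
  have hrank := (isHilbertSchmidt_newtonianOperator hΩ).rank_le_rank_spectralSubspace
    (isSymmetric_newtonianOperator hΩ) ht _ hlt
  rw [rank_fin_fun] at hrank
  exact lt_of_lt_of_le (by exact_mod_cast Nat.lt_succ_self k) hrank

/-- The number of eigenvalues above a positive threshold grows with the domain. -/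
lemma rank_spectralSubspace_le_of_subset (hsub : Ω₁ ⊆ Ω₂) (hm : MeasurableSet Ω₁)
    (h₁ : Bornology.IsBounded Ω₁) (h₂ : Bornology.IsBounded Ω₂) {s t : ℝ} (hs : 0 < s)
    (hst : s < t) :
    Module.rank ℝ (spectralSubspace (newtonianOperator Ω₁ h₁) (Ici t)) ≤
      Module.rank ℝ (spectralSubspace (newtonianOperator Ω₂ h₂) (Ici s)) := by
  -- The variational bound needs a strict inequality, which s < t supplies.
  refine (isHilbertSchmidt_newtonianOperator h₂).rank_le_rank_spectralSubspace
    (isSymmetric_newtonianOperator h₂) hs ((extendByZero hsub hm).comp (Submodule.subtype _))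
    fun v hv => ?_
  simp only [LinearMap.comp_apply, Submodule.subtype_apply]
  rw [inner_newtonianOperator_extendByZero hsub hm h₁ h₂, norm_extendByZero]
  have hpos : 0 < ‖(v : L2 Ω₁)‖ := norm_pos_iff.2 fun h => hv (Subtype.ext h)
  exact lt_of_lt_of_le (mul_lt_mul_of_pos_right hst (pow_pos hpos 2))
    (le_inner_of_mem_spectralSubspace_Ici (isSymmetric_newtonianOperator h₁) v.2)

end testFunctions
end Newtonian

end

theorem mainTheorem3 (d : ℕ) (hd : d = 2 ∨ d = 3)
    (Ω₁ Ω₂ : Set (EuclideanSpace ℝ (Fin d)))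
    (hne₁ : Ω₁.Nonempty) (hopen₁ : IsOpen Ω₁) (hbdd₁ : Bornology.IsBounded Ω₁)
    (hopen₂ : IsOpen Ω₂) (hbdd₂ : Bornology.IsBounded Ω₂)
    (hsub : Ω₁ ⊆ Ω₂) :
    ∀ k : ℕ,
      Newtonian.IsKthEigenvalue (Newtonian.newtonianOperator Ω₁ hbdd₁) k
        (Newtonian.newtonianEigenvalue Ω₁ hbdd₁ k) ∧
      Newtonian.IsKthEigenvalue (Newtonian.newtonianOperator Ω₂ hbdd₂) k
        (Newtonian.newtonianEigenvalue Ω₂ hbdd₂ k) ∧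
      Newtonian.newtonianEigenvalue Ω₁ hbdd₁ k ≤
        Newtonian.newtonianEigenvalue Ω₂ hbdd₂ k := by
  intro k
  have hHS₁ := Newtonian.isHilbertSchmidt_newtonianOperator hbdd₁
  have hHS₂ := Newtonian.isHilbertSchmidt_newtonianOperator hbdd₂
  have hT₁ := Newtonian.isSymmetric_newtonianOperator hbdd₁
  have hT₂ := Newtonian.isSymmetric_newtonianOperator hbdd₂
  obtain ⟨t₁, ht₁, hk₁⟩ :=
    Newtonian.exists_pos_lt_rank_spectralSubspace hd hne₁ hopen₁ hbdd₁ k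
  obtain ⟨t₂, ht₂, hk₂⟩ :=
    Newtonian.exists_pos_lt_rank_spectralSubspace hd (hne₁.mono hsub) hopen₂ hbdd₂ k
  have h₁ := hHS₁.isKthEigenvalue_kthEigenvalue hT₁ ht₁ hk₁
  refine ⟨h₁, hHS₂.isKthEigenvalue_kthEigenvalue hT₂ ht₂ hk₂, ?_⟩
  -- The counts compare only at distinct positive thresholds, so each s < λ_k(Ω₁) is treated
  -- separately; for s ≤ 0, λ_k(Ω₂) ≥ t₂ > 0 suffices.
  refine le_of_forall_lt_imp_le_of_dense fun s hs => ?_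
  rcases le_or_gt s 0 with hs0 | hs0
  · exact hs0.trans (ht₂.le.trans (le_csSup (hHS₂.bddAbove_setOf_lt_rank hT₂ k) hk₂))
  · exact le_csSup (hHS₂.bddAbove_setOf_lt_rank hT₂ k) (h₁.2.trans_le
      (Newtonian.rank_spectralSubspace_le_of_subset hsub hopen₁.measurableSet hbdd₁ hbdd₂ hs0 hs))
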